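/- Let \(\mathbb H\) be the real quaternions and \(\mathbb H[[z]]\) the ring of formal power series over \(\mathbb H\) in a variable \(z\) that commutes with the coefficients. For \(\alpha\in\mathbb H\), \(|\alpha|<1\), let \[ \mathbf b_\alpha(z)=(z-\alpha)(1-z\overline\alpha)^{-1}=(z-\alpha)\sum_{k\ge 0}\overline{\alpha}^{\,k}z^k . \] A Blaschke product of degree \(n\ge 0\) is a power series of the form \(\mathbf b_{\alpha_1}\cdots\mathbf b_{\alpha_n}\phi\) with \(|\alpha_i|<1\) and \(\phi\in\mathbb H\), \(|\phi|=1\); a finite Blaschke product is a Blaschke product of some degree. An element \(\mu\in\mathbb H\) is a right eigenvalue of \(A\in\mathbb H^{n\times n}\) if \(A\mathbf x=\mathbf x\mu\) for some nonzero \(\mathbf x\in\mathbb H^{n\times 1}\), and \(A\) is stable if all its right eigenvalues satisfy \(|\mu|<1\). (1) If \(\begin{bmatrix}A&B\\C&D\end{bmatrix}\in\mathbb H^{(n+1)\times(n+1)}\) with \(D\in\mathbb H\) is unitary and \(A\) is stable, then the power series \[ f(z)=D+zC(I-zA)^{-1}B=D+\sum_{k\ge 1}z^kCA^{k-1}B \]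 is a Blaschke product of degree \(n\), and it is not a Blaschke product of any other degree. (2) Conversely, every Blaschke product \(f\) of degree \(n\) is of the form \(f(z)=D+zC(I-zA)^{-1}B\) for some unitary matrix \(\begin{bmatrix}A&B\\C&D\end{bmatrix}\in\mathbb H^{(n+1)\times(n+1)}\) with \(A\in\mathbb H^{n\times n}\) stable. (3) Such a realization is built recursively from any factorization \(f=\mathbf b_{\alpha_1}\cdots\mathbf b_{\alpha_n}\phi\) with \(|\alpha_i|<1\), \(|\phi|=1\): let \(A_0,B_0,C_0\) be empty, \(D_0=1\), and for \(0\le k<n\), with \(s_{k+1}=\sqrt{1-|\alpha_{k+1}|^2}\), \[ A_{k+1}=\begin{bmatrix}A_k&s_{k+1}B_k\\0&\overline{\alpha}_{k+1}\end{bmatrix},\quad B_{k+1}=\begin{bmatrix}-B_k\alpha_{k+1}\\s_{k+1}\end{bmatrix},\quad C_{k+1}=\begin{bmatrix}C_k&s_{k+1}D_k\end{bmatrix},\quad D_{k+1}=-D_k\alpha_{k+1}. \] (Thus \(A_1=\overline{\alpha}_1\), \(B_1=C_1=\sqrt{1-|\alpha_1|^2}\), \(D_1=-\alpha_1\).) Then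 \(\begin{bmatrix}A_n&B_n\phi\\C_n&D_n\phi\end{bmatrix}\) is unitary, \(A_n\) is stable, and \(f(z)=D_n\phi+zC_n(I-zA_n)^{-1}B_n\phi\). -/

import Mathlib

open scoped Quaternion PowerSeries

namespace QBlaschke

/-! Power series over the quaternions: `ℍ⟦X⟧` is Mathlib's ring of formal power series, with the
convolution product; the variable `X` commutes with the coefficients. -/

/-- The power series `k_α(z) = ∑ ᾱ^k z^k`. -/
noncomputable def kernelSeries (α : ℍ) : ℍ⟦X⟧ :=
  PowerSeries.mk fun k => (star α) ^ k

/-- `k_α` is the formal inverse of the polynomial `1 - z ᾱ` (on the right). -/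
theorem one_sub_mul_kernelSeries (α : ℍ) :
    (1 - PowerSeries.X * PowerSeries.C (star α)) * kernelSeries α = 1 := by
  ext1 k
  rw [sub_mul, one_mul, mul_assoc]
  cases k with
  | zero => simp [kernelSeries]
  | succ k => simp [kernelSeries, PowerSeries.coeff_succ_X_mul, PowerSeries.coeff_one, pow_succ']

/-- `k_α` is the formal inverse of the polynomial `1 - z ᾱ` (on the left). -/
theorem kernelSeries_mul_one_sub (α : ℍ) :
    kernelSeries α * (1 - PowerSeries.X * PowerSeries.C (star α)) = 1 := by
  ext1 k
  rw [mul_sub, mul_one, ← mul_assoc, (PowerSeries.commute_X (kernelSeries α)).eq,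
    mul_assoc]
  cases k with
  | zero => simp [kernelSeries]
  | succ k => simp [kernelSeries, PowerSeries.coeff_succ_X_mul, PowerSeries.coeff_one, pow_succ]

/-- The Blaschke factor `b_α(z) = (z - α)(1 - z ᾱ)⁻¹`. -/
noncomputable def blaschkeFactor (α : ℍ) : ℍ⟦X⟧ :=
  (PowerSeries.X - PowerSeries.C α) * kernelSeries α

/-- The product `b_{α₁}(z) ⋯ b_{αₙ}(z) φ`, in this order. -/
noncomputable def blaschkeProduct {n : ℕ} (α : Fin n → ℍ) (φ : ℍ) : ℍ⟦X⟧ :=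
  (List.ofFn fun i => blaschkeFactor (α i)).prod * PowerSeries.C φ

/-- `f` is a product of `n` Blaschke factors with nodes in the open unit ball and of a unimodular
constant; for `n = 0`, `f` is a unimodular constant. -/
def IsBlaschkeProduct (n : ℕ) (f : ℍ⟦X⟧) : Prop :=
  ∃ (α : Fin n → ℍ) (φ : ℍ), (∀ i, ‖α i‖ < 1) ∧ ‖φ‖ = 1 ∧ f = blaschkeProduct α φ

/-- `μ` is a right eigenvalue of `A`: `A x = x μ` for some nonzero column `x`. -/
def IsRightEigenvalue {n : ℕ} (A : Matrix (Fin n) (Fin n) ℍ) (μ : ℍ) : Prop :=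
  ∃ x : Fin n → ℍ, x ≠ 0 ∧ A.mulVec x = fun i => x i * μ

/-- The right spectrum of a quaternionic matrix. -/
def rightSpectrum {n : ℕ} (A : Matrix (Fin n) (Fin n) ℍ) : Set ℍ :=
  {μ | IsRightEigenvalue A μ}

/-- `A` is stable: its right spectrum lies in the open unit ball. -/
def IsStable {n : ℕ} (A : Matrix (Fin n) (Fin n) ℍ) : Prop :=
  rightSpectrum A ⊆ Metric.ball (0 : ℍ) 1

/-- The four blocks of a quaternionic `(n+1) × (n+1)` matrix `[[A, B], [C, D]]`. -/
structure Blocks (n : ℕ) where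
  /-- the `n × n` block -/
  A : Matrix (Fin n) (Fin n) ℍ
  /-- the `n × 1` block -/
  B : Matrix (Fin n) (Fin 1) ℍ
  /-- the `1 × n` block -/
  C : Matrix (Fin 1) (Fin n) ℍ
  /-- the scalar block -/
  D : ℍ

/-- The matrix `[[A, B], [C, D]]`. -/
def Blocks.toMatrix {n : ℕ} (U : Blocks n) : Matrix (Fin n ⊕ Fin 1) (Fin n ⊕ Fin 1) ℍ :=
  Matrix.fromBlocks U.A U.B U.C !![U.D]

/-- `U U* = U* U = I`, where `U*` is the conjugate transpose. -/
def Blocks.IsUnitary {n : ℕ} (U : Blocks n) : Prop :=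
  U.toMatrix ∈ unitary (Matrix (Fin n ⊕ Fin 1) (Fin n ⊕ Fin 1) ℍ)

/-- The matrix `I - z A` with entries in `ℍ⟦X⟧`. -/
noncomputable def pencil {n : ℕ} (A : Matrix (Fin n) (Fin n) ℍ) :
    Matrix (Fin n) (Fin n) ℍ⟦X⟧ :=
  1 - (PowerSeries.X : ℍ⟦X⟧) • A.map PowerSeries.C

/-- The power series `f(z) = D + z C (I - z A)⁻¹ B`; the inverse is taken in the ring of matrices
over `ℍ⟦X⟧`, where `I - z A` is always invertible. -/
noncomputable def Blocks.transfer {n : ℕ} (U : Blocks n) : ℍ⟦X⟧ :=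
  PowerSeries.C U.D + PowerSeries.X *
    (U.C.map PowerSeries.C * Ring.inverse (pencil U.A) * U.B.map PowerSeries.C) 0 0

/-- The Neumann series `∑ z^k A^k`, as a matrix over `ℍ⟦X⟧`. -/
noncomputable def neumann {n : ℕ} (A : Matrix (Fin n) (Fin n) ℍ) :
    Matrix (Fin n) (Fin n) ℍ⟦X⟧ :=
  Matrix.of fun i j => PowerSeries.mk fun k => (A ^ k) i j

theorem pencil_mul_neumann {n : ℕ} (A : Matrix (Fin n) (Fin n) ℍ) :
    pencil A * neumann A = 1 := by
  ext1 i j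
  ext1 k
  rw [pencil, sub_mul, one_mul, smul_mul_assoc]
  cases k with
  | zero =>
    by_cases h : i = j <;> simp [neumann, Matrix.one_apply, h]
  | succ k =>
    have h1 : PowerSeries.coeff (k + 1) ((1 : Matrix (Fin n) (Fin n) ℍ⟦X⟧) i j) = 0 := by
      by_cases h : i = j <;> simp [Matrix.one_apply, h, PowerSeries.coeff_one]
    rw [h1]
    simp [neumann, Matrix.mul_apply, PowerSeries.coeff_succ_X_mul, pow_succ']

theorem neumann_mul_pencil {n : ℕ} (A : Matrix (Fin n) (Fin n) ℍ) :
    neumann A * pencil A = 1 := by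
  ext1 i j
  ext1 k
  have hX : neumann A * ((PowerSeries.X : ℍ⟦X⟧) • A.map PowerSeries.C) =
      (PowerSeries.X : ℍ⟦X⟧) • (neumann A * A.map PowerSeries.C) := by
    ext1 i j
    simp only [Matrix.mul_apply, Matrix.smul_apply, smul_eq_mul, Finset.mul_sum]
    refine Finset.sum_congr rfl fun l _ => ?_
    rw [← mul_assoc, (PowerSeries.commute_X (neumann A i l)).eq, mul_assoc]
  rw [pencil, mul_sub, mul_one, hX]
  cases k with
  | zero =>
    by_cases h : i = j <;> simp [neumann, Matrix.one_apply, h]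
  | succ k =>
    have h1 : PowerSeries.coeff (k + 1) ((1 : Matrix (Fin n) (Fin n) ℍ⟦X⟧) i j) = 0 := by
      by_cases h : i = j <;> simp [Matrix.one_apply, h, PowerSeries.coeff_one]
    rw [h1]
    simp [neumann, Matrix.mul_apply, PowerSeries.coeff_succ_X_mul, pow_succ]

theorem inverse_pencil {n : ℕ} (A : Matrix (Fin n) (Fin n) ℍ) :
    Ring.inverse (pencil A) = neumann A :=
  Ring.inverse_unit (⟨pencil A, neumann A, pencil_mul_neumann A, neumann_mul_pencil A⟩ :
    (Matrix (Fin n) (Fin n) ℍ⟦X⟧)ˣ)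

/-- The expansion `f(z) = D + ∑_{k ≥ 1} z^k C A^(k-1) B`. -/
theorem Blocks.transfer_eq {n : ℕ} (U : Blocks n) :
    U.transfer = PowerSeries.C U.D +
      PowerSeries.X * PowerSeries.mk fun k => (U.C * U.A ^ k * U.B) 0 0 := by
  rw [Blocks.transfer, inverse_pencil]
  congr 2
  ext1 k
  simp [neumann, Matrix.mul_apply]

/-- The recursive construction of the matrices `U_k = [[A_k, B_k], [C_k, D_k]]` from the nodes:
with `s = √(1 - |α_{k+1}|²)`,
`A_{k+1} = [[A_k, s B_k], [0, ᾱ_{k+1}]]`, `B_{k+1} = [[-B_k α_{k+1}], [s]]`,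
`C_{k+1} = [C_k, s D_k]`, `D_{k+1} = -D_k α_{k+1}`.
The recursion starts with empty `A_0`, `B_0`, `C_0` and `D_0 = 1`, so that `U_1` is
`[[ᾱ_1, √(1 - |α_1|²)], [√(1 - |α_1|²), -α_1]]`. -/
noncomputable def recursiveBlocks : (n : ℕ) → (Fin n → ℍ) → Blocks n
  | 0, _ => { A := 0, B := 0, C := 0, D := 1 }
  | k + 1, α =>
    let U := recursiveBlocks k (Fin.init α)
    let a : ℍ := α (Fin.last k)
    let s : ℍ := ((Real.sqrt (1 - ‖a‖ ^ 2) : ℝ) : ℍ)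
    { A := (Matrix.fromBlocks U.A (U.B * !![s]) 0 !![star a]).submatrix
        finSumFinEquiv.symm finSumFinEquiv.symm
      B := (Matrix.fromRows (-(U.B * !![a])) !![s]).submatrix finSumFinEquiv.symm id
      C := (Matrix.fromCols U.C !![U.D * s]).submatrix id finSumFinEquiv.symm
      D := -(U.D * a) }

/-- The first step of the recursion. -/
theorem recursiveBlocks_one (α : Fin 1 → ℍ) :
    recursiveBlocks 1 α =
      { A := !![star (α 0)]
        B := !![((Real.sqrt (1 - ‖α 0‖ ^ 2) : ℝ) : ℍ)]
        C := !![((Real.sqrt (1 - ‖α 0‖ ^ 2) : ℝ) : ℍ)]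
        D := -α 0 } := by
  have h : finSumFinEquiv.symm (0 : Fin (0 + 1)) = (Sum.inr 0 : Fin 0 ⊕ Fin 1) := by decide
  have h0 : ∀ i : Fin (0 + 1), i = 0 := by decide
  simp only [recursiveBlocks, Blocks.mk.injEq]
  refine ⟨?_, ?_, ?_, ?_⟩
  · ext1 i j
    rw [h0 i, h0 j, Matrix.submatrix_apply, h]
    simp
  · ext1 i j
    rw [h0 i, h0 j, Matrix.submatrix_apply, h]
    simp
  · ext1 i j
    rw [h0 i, h0 j, Matrix.submatrix_apply, h]
    simp
  · simp

/-- The matrix `[[A, B φ], [C, D φ]]`, the product of `[[A, B], [C, D]]` and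
`[[I, 0], [0, φ]]`. -/
noncomputable def Blocks.mulConst {n : ℕ} (U : Blocks n) (φ : ℍ) : Blocks n :=
  { A := U.A, B := U.B * !![φ], C := U.C, D := U.D * φ }

end QBlaschke

namespace QBlaschke

open Matrix

/-! The recursion is a cascade connection. Up to the order of the coordinates, the step with node
`a` multiplies `diag(U, 1)` by a unitary 2 × 2 rotation built from `a` (`toMatrix_step`). Hence it
preserves unitarity, it makes the new state matrix block triangular with the extra diagonal entry
`star a`, and it multiplies the transfer function on the right by the Blaschke factor of `a`
(`transfer_step`). Induction gives the realization of every Blaschke product.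

Conversely, a stable unitary matrix is brought to the form of a step by a unitary change of state,
which does not alter the transfer function. A normalized eigenvector of the adjoint of `A` becomes
the last basis vector, so that the last row of `A` vanishes before the diagonal; its phase makes the
last entry of `B` nonnegative (`exists_conj_last_row`). Unitarity and stability then force the last
row to be that of a step with `‖a‖ < 1`. Peeling off the rotation leaves a smaller unitary matrix,
stable again (`exists_conj_eq_step`), and induction applies.

The degree is read off from the product of `f` with its conjugate series. It is a quotient of real
polynomials: the numerator has degree `2 * n`, with roots in the open disc, and is coprime to the
denominator, whose roots lie outside the closed disc (`IsBlaschkeProduct.degree_unique`). -/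

/-! ### One step of the recursion -/

/-- The step `U_k ↦ U_{k+1}` of the recursive construction, with node `a`. -/
noncomputable def Blocks.step {n : ℕ} (U : Blocks n) (a : ℍ) : Blocks (n + 1) :=
  let s : ℍ := ((Real.sqrt (1 - ‖a‖ ^ 2) : ℝ) : ℍ)
  { A := (Matrix.fromBlocks U.A (U.B * !![s]) 0 !![star a]).submatrix
      finSumFinEquiv.symm finSumFinEquiv.symm
    B := (Matrix.fromRows (-(U.B * !![a])) !![s]).submatrix finSumFinEquiv.symm id
    C := (Matrix.fromCols U.C !![U.D * s]).submatrix id finSumFinEquiv.symm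
    D := -(U.D * a) }

theorem recursiveBlocks_succ {n : ℕ} (α : Fin (n + 1) → ℍ) :
    recursiveBlocks (n + 1) α = (recursiveBlocks n (Fin.init α)).step (α (Fin.last n)) :=
  rfl

section Entries

variable {n : ℕ} (U : Blocks n) (a : ℍ)

@[simp] theorem step_A_castSucc_castSucc (i j : Fin n) :
    (U.step a).A i.castSucc j.castSucc = U.A i j := by
  simp [Blocks.step]

@[simp] theorem step_A_castSucc_last (i : Fin n) :
    (U.step a).A i.castSucc (Fin.last n) = U.B i 0 * ((Real.sqrt (1 - ‖a‖ ^ 2) : ℝ) : ℍ) := by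
  simp [Blocks.step, Matrix.mul_apply]

@[simp] theorem step_A_last_castSucc (j : Fin n) :
    (U.step a).A (Fin.last n) j.castSucc = 0 := by
  simp [Blocks.step]

@[simp] theorem step_A_last_last : (U.step a).A (Fin.last n) (Fin.last n) = star a := by
  simp [Blocks.step]

@[simp] theorem step_B_castSucc (i : Fin n) (j : Fin 1) :
    (U.step a).B i.castSucc j = -(U.B i 0 * a) := by
  simp [Blocks.step, Matrix.mul_apply]

@[simp] theorem step_B_last (j : Fin 1) :
    (U.step a).B (Fin.last n) j = ((Real.sqrt (1 - ‖a‖ ^ 2) : ℝ) : ℍ) := by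
  simp [Blocks.step]

@[simp] theorem step_C_castSucc (i : Fin 1) (j : Fin n) :
    (U.step a).C i j.castSucc = U.C i j := by
  simp [Blocks.step]

@[simp] theorem step_C_last (i : Fin 1) :
    (U.step a).C i (Fin.last n) = U.D * ((Real.sqrt (1 - ‖a‖ ^ 2) : ℝ) : ℍ) := by
  simp [Blocks.step]

@[simp] theorem step_D : (U.step a).D = -(U.D * a) := rfl

end Entries

theorem coe_sqrt_mul_self {a : ℍ} (ha : ‖a‖ ≤ 1) :
    ((Real.sqrt (1 - ‖a‖ ^ 2) : ℝ) : ℍ) * ((Real.sqrt (1 - ‖a‖ ^ 2) : ℝ) : ℍ) =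
      1 - a * star a := by
  have h : 0 ≤ 1 - ‖a‖ ^ 2 := by nlinarith [norm_nonneg a]
  rw [← Quaternion.coe_mul, Real.mul_self_sqrt h, Quaternion.self_mul_star,
    Quaternion.normSq_eq_norm_mul_self]
  push_cast
  rw [sq]

/-! ### Transfer functions through state vectors -/

/-- The equation `x = B + z A x` has the single solution `(I - z A)⁻¹ B`. A transfer function can
thus be computed by guessing the state series, without inverting a block matrix. -/
theorem transfer_eq_of_state {n : ℕ} (U : Blocks n) (x : Fin n → ℍ⟦X⟧)
    (hx : ∀ i, x i = PowerSeries.C (U.B i 0) +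
      PowerSeries.X * ∑ j, PowerSeries.C (U.A i j) * x j) :
    U.transfer = PowerSeries.C U.D +
      PowerSeries.X * ∑ j, PowerSeries.C (U.C 0 j) * x j := by
  have h : pencil U.A * (Matrix.of fun i (_ : Fin 1) => x i) = U.B.map PowerSeries.C := by
    ext1 i j
    have hj : j = 0 := Subsingleton.elim _ _
    rw [pencil, Matrix.sub_mul, Matrix.one_mul, Matrix.smul_mul, Matrix.sub_apply,
      Matrix.smul_apply, Matrix.mul_apply, Matrix.of_apply, hx i, hj]
    simp
  rw [Blocks.transfer, inverse_pencil, ← h, Matrix.mul_assoc, ← Matrix.mul_assoc (neumann U.A),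
    neumann_mul_pencil, Matrix.one_mul]
  simp [Matrix.mul_apply]

theorem exists_state {n : ℕ} (U : Blocks n) :
    ∃ x : Fin n → ℍ⟦X⟧, ∀ i, x i = PowerSeries.C (U.B i 0) +
      PowerSeries.X * ∑ j, PowerSeries.C (U.A i j) * x j := by
  refine ⟨fun i => (neumann U.A * U.B.map PowerSeries.C) i 0, fun i => ?_⟩
  have h : pencil U.A * (neumann U.A * U.B.map PowerSeries.C) = U.B.map PowerSeries.C := by
    rw [← Matrix.mul_assoc, pencil_mul_neumann, Matrix.one_mul]
  have h' := congrFun (congrFun h i) 0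
  rw [pencil, Matrix.sub_mul, Matrix.one_mul, Matrix.smul_mul, Matrix.sub_apply,
    Matrix.smul_apply, sub_eq_iff_eq_add] at h'
  refine h'.trans ?_
  simp [Matrix.mul_apply]

theorem kernelSeries_eq (a : ℍ) :
    kernelSeries a = 1 + PowerSeries.X * (PowerSeries.C (star a) * kernelSeries a) := by
  have h := one_sub_mul_kernelSeries a
  rw [sub_mul, one_mul, sub_eq_iff_eq_add, mul_assoc] at h
  exact h

/-- This is the one-state realization of the Blaschke factor; it amounts to `s² = 1 - a ā`. -/
theorem blaschkeFactor_eq {a : ℍ} (ha : ‖a‖ ≤ 1) :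
    blaschkeFactor a = -PowerSeries.C a + PowerSeries.X *
      (PowerSeries.C ((Real.sqrt (1 - ‖a‖ ^ 2) : ℝ) : ℍ) *
        (PowerSeries.C ((Real.sqrt (1 - ‖a‖ ^ 2) : ℝ) : ℍ) * kernelSeries a)) := by
  have h : PowerSeries.C a * kernelSeries a = PowerSeries.C a +
      PowerSeries.X * (PowerSeries.C a * (PowerSeries.C (star a) * kernelSeries a)) := by
    conv_lhs => rw [kernelSeries_eq a, mul_add, mul_one, ← mul_assoc, ← PowerSeries.X_mul]
    rw [mul_assoc]
  rw [← mul_assoc (PowerSeries.C _), ← map_mul, coe_sqrt_mul_self ha, blaschkeFactor, sub_mul, h,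
    map_sub, map_one, sub_mul, one_mul, map_mul, mul_sub, mul_assoc (PowerSeries.C a)]
  abel

theorem transfer_step {n : ℕ} (U : Blocks n) {a : ℍ} (ha : ‖a‖ ≤ 1) :
    (U.step a).transfer = U.transfer * blaschkeFactor a := by
  obtain ⟨x, hx⟩ := exists_state U
  rw [transfer_eq_of_state U x hx]
  -- In the cascade the input first passes through the Blaschke factor, whose own state is `s k_a`,
  -- and its output drives `U`, whose state becomes `x b_a`.
  rw [transfer_eq_of_state (U.step a) (Fin.lastCases
    (PowerSeries.C ((Real.sqrt (1 - ‖a‖ ^ 2) : ℝ) : ℍ) * kernelSeries a)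
    (fun i => x i * blaschkeFactor a))]
  · simp only [Fin.sum_univ_castSucc, Fin.lastCases_castSucc, Fin.lastCases_last,
      step_C_castSucc, step_C_last, step_D, map_neg, map_mul, ← mul_assoc (PowerSeries.C (U.C 0 _)),
      ← Finset.sum_mul]
    rw [add_mul, mul_add, ← mul_assoc PowerSeries.X _ (blaschkeFactor a),
      blaschkeFactor_eq ha, mul_add (PowerSeries.C U.D)]
    rw [← mul_assoc (PowerSeries.C U.D) PowerSeries.X, ← PowerSeries.X_mul (φ := PowerSeries.C U.D)]
    simp only [mul_assoc, mul_neg]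
    abel
  · refine Fin.lastCases ?_ fun i => ?_
    · simp only [Fin.sum_univ_castSucc, Fin.lastCases_castSucc, Fin.lastCases_last,
        step_A_last_castSucc, step_A_last_last, step_B_last, map_zero, zero_mul,
        Finset.sum_const_zero, zero_add]
      conv_lhs => rw [kernelSeries_eq a, mul_add, mul_one]
      congr 1
      rw [← mul_assoc, ← PowerSeries.X_mul, mul_assoc, ← mul_assoc (PowerSeries.C _),
        ← mul_assoc (PowerSeries.C (star a)), ← map_mul, ← map_mul, Quaternion.coe_commutes]
    · simp only [Fin.sum_univ_castSucc, Fin.lastCases_castSucc, Fin.lastCases_last,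
        step_A_castSucc_castSucc, step_A_castSucc_last, step_B_castSucc, map_neg, map_mul,
        ← mul_assoc (PowerSeries.C (U.A i _)), ← Finset.sum_mul]
      conv_lhs => rw [hx i]
      rw [add_mul, mul_add, ← mul_assoc PowerSeries.X _ (blaschkeFactor a),
        blaschkeFactor_eq ha, mul_add (PowerSeries.C (U.B i 0))]
      rw [← mul_assoc (PowerSeries.C (U.B i 0)) PowerSeries.X,
        ← PowerSeries.X_mul (φ := PowerSeries.C (U.B i 0))]
      simp only [mul_assoc, mul_neg]
      abel

theorem transfer_mulConst {n : ℕ} (U : Blocks n) (φ : ℍ) :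
    (U.mulConst φ).transfer = U.transfer * PowerSeries.C φ := by
  obtain ⟨x, hx⟩ := exists_state U
  rw [transfer_eq_of_state U x hx,
    transfer_eq_of_state (U.mulConst φ) (fun i => x i * PowerSeries.C φ)]
  · simp only [Blocks.mulConst, map_mul, add_mul, mul_assoc, Finset.sum_mul]
  · intro i
    conv_lhs => rw [hx i]
    simp [Blocks.mulConst, Matrix.mul_apply, add_mul, mul_assoc, Finset.sum_mul]

/-! ### Stability of a step -/

theorem isStable_step_iff {n : ℕ} (U : Blocks n) {a : ℍ} (ha : ‖a‖ < 1) :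
    IsStable (U.step a).A ↔ IsStable U.A := by
  constructor
  · rintro h μ ⟨x, hx, hμ⟩
    refine h ⟨Fin.lastCases 0 x, ?_, ?_⟩
    · contrapose! hx
      ext1 i
      simpa using congrFun hx i.castSucc
    · ext1 i
      refine Fin.lastCases ?_ (fun i => ?_) i
      · simp [Matrix.mulVec, dotProduct, Fin.sum_univ_castSucc]
      · have := congrFun hμ i
        simpa [Matrix.mulVec, dotProduct, Fin.sum_univ_castSucc] using this
  · rintro h μ ⟨x, hx, hμ⟩
    by_cases h0 : x (Fin.last n) = 0
    · refine h ⟨fun i => x i.castSucc, ?_, ?_⟩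
      · contrapose! hx
        ext1 i
        refine Fin.lastCases h0 (fun i => ?_) i
        exact congrFun hx i
      · ext1 i
        have := congrFun hμ i.castSucc
        simpa [Matrix.mulVec, dotProduct, Fin.sum_univ_castSucc, h0] using this
    -- The last coordinate `q` satisfies `ā q = q μ`. Thus `μ` is only conjugate to `ā`, but its
    -- norm is `‖a‖`.
    · have := congrArg norm (congrFun hμ (Fin.last n))
      simp [Matrix.mulVec, dotProduct, Fin.sum_univ_castSucc] at this
      rw [mul_comm, mul_right_inj' (norm_ne_zero_iff.mpr h0)] at this
      simpa [← this] using ha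

/-! ### Unitarity of a step -/

theorem isUnitary_iff {n : ℕ} (U : Blocks n) : U.IsUnitary ↔ U.toMatrix * star U.toMatrix = 1 :=
  ⟨fun h => h.2, fun h => ⟨mul_eq_one_symm h, h⟩⟩

/-- The index equivalence which moves the last state behind the input or output. -/
def stateEquiv (n : ℕ) : Fin (n + 1) ⊕ Fin 1 ≃ (Fin n ⊕ Fin 1) ⊕ Fin 1 :=
  (finSumFinEquiv.symm.sumCongr (Equiv.refl _)).trans
    ((Equiv.sumAssoc _ _ _).trans (((Equiv.refl _).sumCongr (Equiv.sumComm _ _)).trans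
      (Equiv.sumAssoc _ _ _).symm))

@[simp] theorem stateEquiv_inl_castSucc {n : ℕ} (i : Fin n) :
    stateEquiv n (Sum.inl i.castSucc) = Sum.inl (Sum.inl i) := by
  simp [stateEquiv]

@[simp] theorem stateEquiv_inl_last {n : ℕ} :
    stateEquiv n (Sum.inl (Fin.last n)) = Sum.inr 0 := by
  simp [stateEquiv]

@[simp] theorem stateEquiv_inr {n : ℕ} (i : Fin 1) :
    stateEquiv n (Sum.inr i) = Sum.inl (Sum.inr i) := by
  simp [stateEquiv]

/-- The elementary unitary matrix `[[-a, s], [s, ā]]`, acting on the last two coordinates. -/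
noncomputable def elementary (n : ℕ) (a : ℍ) :
    Matrix ((Fin n ⊕ Fin 1) ⊕ Fin 1) ((Fin n ⊕ Fin 1) ⊕ Fin 1) ℍ :=
  let s : ℍ := ((Real.sqrt (1 - ‖a‖ ^ 2) : ℝ) : ℍ)
  Matrix.fromBlocks (Matrix.fromBlocks 1 0 0 !![-a]) (Matrix.fromRows 0 !![s])
    (Matrix.fromCols 0 !![s]) !![star a]

theorem elementary_mul_star (n : ℕ) {a : ℍ} (ha : ‖a‖ ≤ 1) :
    elementary n a * star (elementary n a) = 1 := by
  have h1 := coe_sqrt_mul_self ha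
  have h2 : star a * a = a * star a := by rw [Quaternion.star_mul_self, Quaternion.self_mul_star]
  ext1 i j
  rcases i with (i | i) | i <;> rcases j with (j | j) | j <;>
    try obtain rfl := Subsingleton.elim i 0
  all_goals try obtain rfl := Subsingleton.elim j 0
  all_goals
    simp [elementary, Matrix.mul_apply, Matrix.star_apply, Fintype.sum_sum_type, Matrix.one_apply,
      h1, h2, Quaternion.coe_commutes, eq_comm, apply_ite star, -Quaternion.coe_mul]

/-- This factorization reduces unitarity of a step to that of its two factors, and read backwards it
allows a step to be undone. -/
theorem toMatrix_step {n : ℕ} (U : Blocks n) (a : ℍ) :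
    (U.step a).toMatrix =
      (Matrix.fromBlocks U.toMatrix 0 0 1 * elementary n a).submatrix
        (stateEquiv n) (stateEquiv n) := by
  ext1 i j
  rcases i with i | i <;> rcases j with j | j
  · refine Fin.lastCases ?_ (fun i => ?_) i <;> refine Fin.lastCases ?_ (fun j => ?_) j <;>
    simp [elementary, Blocks.toMatrix, Matrix.mul_apply, Fintype.sum_sum_type, Matrix.one_apply]
  · refine Fin.lastCases ?_ (fun i => ?_) i <;>
    simp [elementary, Blocks.toMatrix, Matrix.mul_apply, Fintype.sum_sum_type, Matrix.one_apply,
      Subsingleton.elim j 0]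
  · refine Fin.lastCases ?_ (fun j => ?_) j <;>
    simp [elementary, Blocks.toMatrix, Matrix.mul_apply, Fintype.sum_sum_type, Matrix.one_apply,
      Subsingleton.elim i 0]
  · simp [elementary, Blocks.toMatrix, Matrix.mul_apply, Fintype.sum_sum_type,
      Subsingleton.elim i 0, Subsingleton.elim j 0]

theorem fromBlocks_one_mul_star {m : Type*} [Fintype m] [DecidableEq m] (M : Matrix m m ℍ) :
    Matrix.fromBlocks M 0 0 (1 : Matrix (Fin 1) (Fin 1) ℍ) *
      star (Matrix.fromBlocks M 0 0 (1 : Matrix (Fin 1) (Fin 1) ℍ)) =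
      Matrix.fromBlocks (M * star M) 0 0 1 := by
  simp [Matrix.star_eq_conjTranspose, Matrix.fromBlocks_conjTranspose, Matrix.fromBlocks_multiply]

theorem Blocks.IsUnitary.step {n : ℕ} {U : Blocks n} (hU : U.IsUnitary) {a : ℍ} (ha : ‖a‖ ≤ 1) :
    (U.step a).IsUnitary := by
  rw [isUnitary_iff] at hU ⊢
  rw [toMatrix_step, Matrix.star_eq_conjTranspose, Matrix.conjTranspose_submatrix,
    Matrix.submatrix_mul_equiv, ← Matrix.star_eq_conjTranspose, star_mul, mul_assoc,
    ← mul_assoc (elementary n a), elementary_mul_star n ha, one_mul, fromBlocks_one_mul_star, hU,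
    Matrix.fromBlocks_one, Matrix.submatrix_one_equiv]

theorem Blocks.IsUnitary.mulConst {n : ℕ} {U : Blocks n} (hU : U.IsUnitary) {φ : ℍ}
    (hφ : ‖φ‖ = 1) : (U.mulConst φ).IsUnitary := by
  have h : (U.mulConst φ).toMatrix = U.toMatrix * Matrix.fromBlocks 1 0 0 !![φ] := by
    simp [Blocks.toMatrix, Blocks.mulConst, Matrix.fromBlocks_multiply]
  have hφ' : φ * star φ = 1 := by
    rw [Quaternion.self_mul_star, Quaternion.normSq_eq_norm_mul_self, hφ]; simp
  have h1 : (Matrix.fromBlocks 1 0 0 !![φ] : Matrix (Fin n ⊕ Fin 1) (Fin n ⊕ Fin 1) ℍ) *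
      star (Matrix.fromBlocks 1 0 0 !![φ]) = 1 := by
    ext1 i j
    rcases i with i | i <;> rcases j with j | j <;> try obtain rfl := Subsingleton.elim i 0
    all_goals try obtain rfl := Subsingleton.elim j 0
    all_goals
      simp [Matrix.mul_apply, Matrix.star_apply, Fintype.sum_sum_type, Matrix.one_apply, hφ',
        eq_comm, apply_ite star]
  rw [isUnitary_iff] at hU ⊢
  rw [h, star_mul, mul_assoc, ← mul_assoc (Matrix.fromBlocks 1 0 0 _), h1, one_mul, hU]

/-! ### The recursive realization -/

theorem blaschkeProduct_succ {n : ℕ} (α : Fin (n + 1) → ℍ) (φ : ℍ) :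
    blaschkeProduct α φ =
      blaschkeProduct (Fin.init α) 1 * blaschkeFactor (α (Fin.last n)) * PowerSeries.C φ := by
  rw [blaschkeProduct, blaschkeProduct, List.ofFn_succ', List.concat_eq_append]
  simp [Fin.init]

theorem recursiveBlocks_spec {n : ℕ} (α : Fin n → ℍ) (hα : ∀ i, ‖α i‖ < 1) :
    (recursiveBlocks n α).IsUnitary ∧ IsStable (recursiveBlocks n α).A ∧
      (recursiveBlocks n α).transfer = blaschkeProduct α 1 := by
  induction n with
  | zero =>
    refine ⟨?_, ?_, ?_⟩
    · rw [isUnitary_iff]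
      ext1 i j
      rcases i with i | i
      · exact i.elim0
      rcases j with j | j
      · exact j.elim0
      obtain rfl := Subsingleton.elim i 0
      obtain rfl := Subsingleton.elim j 0
      simp [recursiveBlocks, Blocks.toMatrix, Matrix.mul_apply, Matrix.star_apply]
    · rintro μ ⟨x, hx, -⟩
      exact (hx (Subsingleton.elim _ _)).elim
    · rw [transfer_eq_of_state _ 0 fun i => i.elim0]
      simp [recursiveBlocks, blaschkeProduct]
  | succ n ih =>
    obtain ⟨h1, h2, h3⟩ := ih (Fin.init α) fun i => hα i.castSucc
    have ha := hα (Fin.last n)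
    rw [recursiveBlocks_succ]
    refine ⟨h1.step ha.le, (isStable_step_iff _ ha).mpr h2, ?_⟩
    rw [transfer_step _ ha.le, h3, blaschkeProduct_succ]
    simp

theorem recursiveBlocks_mulConst_spec {n : ℕ} (α : Fin n → ℍ) (φ : ℍ) (hα : ∀ i, ‖α i‖ < 1)
    (hφ : ‖φ‖ = 1) :
    ((recursiveBlocks n α).mulConst φ).IsUnitary ∧
      IsStable ((recursiveBlocks n α).mulConst φ).A ∧
      blaschkeProduct α φ = ((recursiveBlocks n α).mulConst φ).transfer := by
  obtain ⟨h1, h2, h3⟩ := recursiveBlocks_spec α hα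
  refine ⟨h1.mulConst hφ, h2, ?_⟩
  rw [transfer_mulConst, h3]
  simp [blaschkeProduct]

/-! ### Right eigenvalues exist -/

/-- Right multiplication by complex numbers commutes with the left action of `A`. So `A` is an
endomorphism of a nonzero finite-dimensional complex space and has a complex eigenvalue. -/
theorem exists_isRightEigenvalue {n : ℕ} (A : Matrix (Fin (n + 1)) (Fin (n + 1)) ℍ) :
    ∃ μ, IsRightEigenvalue A μ := by
  let _ : Module ℂ (Fin (n + 1) → ℍ) := Module.compHom _
    ((Quaternion.ofComplex : ℂ →+* ℍ).toOpposite fun x y => (Commute.all x y).map _)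
  have smul_def : ∀ (c : ℂ) (x : Fin (n + 1) → ℍ), c • x = fun i => x i * (c : ℍ) :=
    fun _ _ => rfl
  have : IsScalarTower ℝ ℂ (Fin (n + 1) → ℍ) := ⟨fun r c x => by
    rw [smul_def, smul_def]
    ext1 i
    rw [Pi.smul_apply, ← mul_smul_comm]
    congr 1
    exact map_smul Quaternion.ofComplex r c⟩
  have : FiniteDimensional ℂ (Fin (n + 1) → ℍ) :=
    Module.Finite.of_restrictScalars_finite ℝ ℂ _
  let f : Module.End ℂ (Fin (n + 1) → ℍ) :=
    { toFun := A.mulVec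
      map_add' := A.mulVec_add
      map_smul' := fun c x => by
        rw [smul_def, RingHom.id_apply, smul_def]
        ext1 i
        simp only [Matrix.mulVec, dotProduct, Finset.sum_mul, mul_assoc] }
  obtain ⟨c, hc⟩ := Module.End.exists_eigenvalue f
  obtain ⟨x, hx⟩ := hc.exists_hasEigenvector
  exact ⟨c, x, hx.2, hx.apply_eq_smul⟩

/-! ### Unit vectors as columns of unitary matrices -/

theorem star_mul_self_eq_norm_sq (q : ℍ) : star q * q = ((‖q‖ ^ 2 : ℝ) : ℍ) := by
  rw [Quaternion.star_mul_self, Quaternion.normSq_eq_norm_mul_self, sq]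

theorem mul_star_self_eq_norm_sq (q : ℍ) : q * star q = ((‖q‖ ^ 2 : ℝ) : ℍ) := by
  rw [Quaternion.self_mul_star, Quaternion.normSq_eq_norm_mul_self, sq]

theorem exists_phase (q : ℍ) : ∃ u : ℍ, ‖u‖ = 1 ∧ q = u * ((‖q‖ : ℝ) : ℍ) := by
  by_cases hq : q = 0
  · exact ⟨1, by simp [hq]⟩
  · have h : ‖q‖ ≠ 0 := norm_ne_zero_iff.mpr hq
    refine ⟨q * ((‖q‖⁻¹ : ℝ) : ℍ), ?_, ?_⟩
    · rw [norm_mul, Quaternion.norm_coe, Real.norm_of_nonneg (by positivity), mul_inv_cancel₀ h]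
    · rw [mul_assoc, ← Quaternion.coe_mul, inv_mul_cancel₀ h]
      simp

/-- A quaternionic Householder reflection. -/
theorem exists_unitary_col_of_last_real {n : ℕ} (y : Fin (n + 1) → ℍ) (hy : ∑ i, ‖y i‖ ^ 2 = 1)
    {r : ℝ} (hr : y (Fin.last n) = (r : ℍ)) (hr0 : 0 ≤ r) :
    ∃ H : Matrix (Fin (n + 1)) (Fin (n + 1)) ℍ, Hᴴ * H = 1 ∧ ∀ i, H i (Fin.last n) = y i := by
  -- Reflecting along `V = y - e`, with `e` the last basis vector, sends `e` to `y` because the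
  -- inner product of the two is the real number `r`. Since `V* V = 2 (1 - r)`, the coefficient `2 /
  -- (V* V)` is `(1 - r)⁻¹`.
  let V : Matrix (Fin (n + 1)) (Fin 1) ℍ :=
    Matrix.of fun i _ => y i - if i = Fin.last n then 1 else 0
  have hlast : ‖y (Fin.last n)‖ = r := by
    rw [hr, Quaternion.norm_coe, Real.norm_of_nonneg hr0]
  have hV : Vᴴ * V = (2 * (1 - r)) • (1 : Matrix (Fin 1) (Fin 1) ℍ) := by
    ext1 i j
    obtain rfl := Subsingleton.elim i 0
    obtain rfl := Subsingleton.elim j 0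
    have h1 : ∀ i, star (y i - if i = Fin.last n then 1 else 0) *
        (y i - if i = Fin.last n then 1 else 0) =
        (((‖y i‖ ^ 2 + if i = Fin.last n then 1 - 2 * r else 0 : ℝ)) : ℍ) := by
      intro i
      split_ifs with hi
      · subst hi
        rw [hlast, hr, star_sub, star_one, Quaternion.star_coe, ← Quaternion.coe_one,
          ← Quaternion.coe_sub, ← Quaternion.coe_mul]
        congr 1
        ring
      · simp only [sub_zero, add_zero]
        exact star_mul_self_eq_norm_sq _
    have h2 : (Vᴴ * V) 0 0 = ∑ i, star (y i - if i = Fin.last n then 1 else 0) *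
        (y i - if i = Fin.last n then 1 else 0) := rfl
    have h3 : ∑ i, (‖y i‖ ^ 2 + if i = Fin.last n then 1 - 2 * r else 0 : ℝ) = 2 * (1 - r) := by
      rw [Finset.sum_add_distrib, hy]
      simp
      ring
    have h4 := (map_sum (algebraMap ℝ ℍ)
      (fun i => ‖y i‖ ^ 2 + if i = Fin.last n then 1 - 2 * r else 0) Finset.univ).symm
    rw [h2, Finset.sum_congr rfl fun i _ => h1 i, Matrix.smul_apply, Matrix.one_apply_eq,
      ← Algebra.algebraMap_eq_smul_one, ← h3]
    exact h4
  refine ⟨1 - (1 - r)⁻¹ • (V * Vᴴ), ?_, fun i => ?_⟩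
  · have hs : (1 - (1 - r)⁻¹ • (V * Vᴴ))ᴴ = 1 - (1 - r)⁻¹ • (V * Vᴴ) := by
      rw [Matrix.conjTranspose_sub, Matrix.conjTranspose_one]
      congr 1
      ext1 i j
      rw [Matrix.conjTranspose_apply, Matrix.smul_apply, Quaternion.star_smul,
        ← Matrix.conjTranspose_apply, Matrix.conjTranspose_mul, Matrix.conjTranspose_conjTranspose]
      rfl
    have hVV : (V * Vᴴ) * (V * Vᴴ) = (2 * (1 - r)) • (V * Vᴴ) := by
      rw [Matrix.mul_assoc, ← Matrix.mul_assoc Vᴴ, hV]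
      simp
    rw [hs, sub_mul, one_mul, mul_sub, mul_one, smul_mul_smul_comm, hVV, smul_smul]
    have hc : (1 - r)⁻¹ * (1 - r)⁻¹ * (2 * (1 - r)) = (1 - r)⁻¹ + (1 - r)⁻¹ := by
      by_cases h : 1 - r = 0
      · simp [h]
      · field_simp
        ring
    rw [hc, add_smul]
    abel
  · have h1 : (V * Vᴴ) i (Fin.last n) = (y i - if i = Fin.last n then 1 else 0) *
        ((r - 1 : ℝ) : ℍ) := by
      simp [V, Matrix.mul_apply, hr]
    rw [Matrix.sub_apply, Matrix.smul_apply, h1]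
    -- If `r = 1` then `y = e`; the convention `0⁻¹ = 0` makes the matrix the identity, as needed.
    by_cases h : 1 - r = 0
    · have hz : y i = if i = Fin.last n then 1 else 0 := by
        have hr1 : r = 1 := by linarith
        split_ifs with hi
        · rw [hi, hr, hr1]
          simp
        · rw [Fin.sum_univ_castSucc, hlast, hr1] at hy
          obtain ⟨j, rfl⟩ := Fin.exists_castSucc_eq.mpr hi
          have h0 : ∑ j : Fin n, ‖y j.castSucc‖ ^ 2 = 0 := by linarith
          have := (Finset.sum_eq_zero_iff_of_nonneg fun j _ => by positivity).mp h0 j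
            (Finset.mem_univ _)
          simpa using this
      simp [h, hz, Matrix.one_apply]
    · rw [← Quaternion.coe_commutes, ← Quaternion.coe_mul_eq_smul, ← mul_assoc,
        ← Quaternion.coe_mul]
      have : (1 - r)⁻¹ * (r - 1) = -1 := by
        field_simp
        ring
      rw [this]
      simp [Matrix.one_apply]

theorem exists_unitary_col {n : ℕ} (x : Fin (n + 1) → ℍ) (hx : ∑ i, ‖x i‖ ^ 2 = 1) :
    ∃ H : Matrix (Fin (n + 1)) (Fin (n + 1)) ℍ, Hᴴ * H = 1 ∧ ∀ i, H i (Fin.last n) = x i := by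
  -- With this `u` the last entry of `x u` is real and nonnegative; the factor `u` is undone at the
  -- end by a scalar diagonal matrix.
  obtain ⟨u, hu, hxu⟩ := exists_phase (star (x (Fin.last n)))
  have huu : star u * u = 1 := by rw [star_mul_self_eq_norm_sq, hu]; simp
  have huu' : u * star u = 1 := by rw [mul_star_self_eq_norm_sq, hu]; simp
  obtain ⟨H, hH, hHx⟩ := exists_unitary_col_of_last_real (fun i => x i * u)
    (by simpa [norm_mul, hu] using hx) (r := ‖x (Fin.last n)‖) (by
      have := congrArg star hxu
      rw [star_star, star_mul, Quaternion.star_coe, norm_star] at this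
      conv_lhs => rw [this]
      rw [mul_assoc, huu, mul_one]) (norm_nonneg _)
  let E : Matrix (Fin (n + 1)) (Fin (n + 1)) ℍ := Matrix.diagonal fun _ => star u
  refine ⟨H * E, ?_, fun i => ?_⟩
  · rw [Matrix.conjTranspose_mul, Matrix.mul_assoc, ← Matrix.mul_assoc Hᴴ, hH, Matrix.one_mul]
    simp [E, Matrix.diagonal_conjTranspose, Matrix.diagonal_mul_diagonal, huu', Pi.star_def]
  · rw [Matrix.mul_diagonal, hHx, mul_assoc, huu', mul_one]

/-! ### Unitary similarity -/

/-- The blocks `[[H* A H, H* B], [C H, D]]`. -/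
noncomputable def Blocks.conj {n : ℕ} (U : Blocks n) (H : Matrix (Fin n) (Fin n) ℍ) : Blocks n :=
  { A := Hᴴ * U.A * H, B := Hᴴ * U.B, C := U.C * H, D := U.D }

theorem transfer_conj {n : ℕ} (U : Blocks n) {H : Matrix (Fin n) (Fin n) ℍ} (hH : H * Hᴴ = 1) :
    (U.conj H).transfer = U.transfer := by
  have h : ∀ k : ℕ, H * (Hᴴ * U.A * H) ^ k = U.A ^ k * H := by
    intro k
    induction k with
    | zero => simp
    | succ k ih =>
      rw [pow_succ, ← mul_assoc, ih, pow_succ, mul_assoc, ← mul_assoc H, ← mul_assoc H, hH,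
        one_mul, mul_assoc]
  rw [Blocks.transfer_eq, Blocks.transfer_eq]
  congr 3
  ext1 k
  rw [Blocks.conj, Matrix.mul_assoc U.C, h, ← Matrix.mul_assoc, ← Matrix.mul_assoc,
    Matrix.mul_assoc _ H, hH, Matrix.mul_one]

theorem IsStable.conj {n : ℕ} {U : Blocks n} (hU : IsStable U.A)
    {H : Matrix (Fin n) (Fin n) ℍ} (hH : H * Hᴴ = 1) : IsStable (U.conj H).A := by
  rintro μ ⟨x, hx, hμ⟩
  refine hU ⟨H.mulVec x, fun h0 => hx ?_, ?_⟩
  · rw [← Matrix.one_mulVec x, ← mul_eq_one_symm hH, ← Matrix.mulVec_mulVec, h0,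
      Matrix.mulVec_zero]
  · have h1 : H.mulVec ((U.conj H).A.mulVec x) = U.A.mulVec (H.mulVec x) := by
      rw [Matrix.mulVec_mulVec, Matrix.mulVec_mulVec, Blocks.conj, ← Matrix.mul_assoc,
        ← Matrix.mul_assoc, hH, Matrix.one_mul]
    rw [← h1, hμ]
    ext1 i
    simp only [Matrix.mulVec, dotProduct, Finset.sum_mul, mul_assoc]

theorem Blocks.IsUnitary.conj {n : ℕ} {U : Blocks n} (hU : U.IsUnitary)
    {H : Matrix (Fin n) (Fin n) ℍ} (hH : H * Hᴴ = 1) : (U.conj H).IsUnitary := by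
  let K : Matrix (Fin n ⊕ Fin 1) (Fin n ⊕ Fin 1) ℍ := Matrix.fromBlocks H 0 0 1
  have hK : K * star K = 1 := by
    rw [fromBlocks_one_mul_star, Matrix.star_eq_conjTranspose, hH, Matrix.fromBlocks_one]
  have h : (U.conj H).toMatrix = star K * U.toMatrix * K := by
    simp [K, Blocks.toMatrix, Blocks.conj, Matrix.star_eq_conjTranspose,
      Matrix.fromBlocks_conjTranspose, Matrix.fromBlocks_multiply]
  rw [isUnitary_iff] at hU ⊢
  rw [h, star_mul, star_mul, star_star, mul_assoc, mul_assoc, ← mul_assoc K, hK, one_mul,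
    ← mul_assoc U.toMatrix, hU, one_mul, mul_eq_one_symm hK]

/-- Every matrix of blocks is unitarily similar to one in which the last row of `A` is zero before
the diagonal and the last entry of `B` is nonnegative. -/
theorem exists_conj_last_row {n : ℕ} (U : Blocks (n + 1)) :
    ∃ (H : Matrix (Fin (n + 1)) (Fin (n + 1)) ℍ) (a : ℍ) (s : ℝ), H * Hᴴ = 1 ∧ 0 ≤ s ∧
      (∀ j : Fin n, (U.conj H).A (Fin.last n) j.castSucc = 0) ∧
      (U.conj H).A (Fin.last n) (Fin.last n) = star a ∧
      (U.conj H).B (Fin.last n) 0 = (s : ℍ) := by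
  -- Taking adjoints gives `x* A = μ̄ x*`, so with `x` as last column of `H` the last row of `H* A
  -- H` is a multiple of a basis row. Replacing `x` by `x u` conjugates `μ` and turns `x* B` into
  -- its norm.
  obtain ⟨μ, x, hx, hμ⟩ := exists_isRightEigenvalue U.Aᴴ
  set β : ℍ := ∑ i, star (x i) * U.B i 0 with hβ
  obtain ⟨u, hu, hβu⟩ := exists_phase β
  have huu : star u * u = 1 := by rw [star_mul_self_eq_norm_sq, hu]; simp
  have huu' : u * star u = 1 := by rw [mul_star_self_eq_norm_sq, hu]; simp
  have hpos : 0 < ∑ i, ‖x i‖ ^ 2 := by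
    obtain ⟨i, hi⟩ := Function.ne_iff.mp hx
    have : 0 < ‖x i‖ := norm_pos_iff.mpr hi
    exact Finset.sum_pos' (fun i _ => by positivity) ⟨i, Finset.mem_univ _, by positivity⟩
  set c : ℝ := (Real.sqrt (∑ i, ‖x i‖ ^ 2))⁻¹ with hc
  have hc0 : 0 ≤ c := by positivity
  obtain ⟨H, hH, hHx⟩ := exists_unitary_col (fun i => x i * u * (c : ℍ)) (by
    simp only [norm_mul, hu, mul_one, Quaternion.norm_coe, Real.norm_of_nonneg hc0, mul_pow]
    rw [← Finset.sum_mul, hc, inv_pow, Real.sq_sqrt hpos.le, mul_inv_cancel₀ hpos.ne'])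
  have hrow : ∀ j, (Hᴴ * U.A) (Fin.last n) j = star (star u * μ * u) * Hᴴ (Fin.last n) j := by
    intro j
    have h1 : (U.Aᴴ).mulVec x j = x j * μ := congrFun hμ j
    have h2 : (Hᴴ * U.A) (Fin.last n) j = star ((U.Aᴴ).mulVec x j * u * (c : ℍ)) := by
      simp only [Matrix.mul_apply, Matrix.mulVec, dotProduct, Matrix.conjTranspose_apply, hHx,
        Finset.sum_mul, star_sum, star_mul, star_star, mul_assoc]
    have h3 : x j * μ * u * (c : ℍ) = x j * u * (c : ℍ) * (star u * μ * u) := by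
      rw [mul_assoc _ (c : ℍ), Quaternion.coe_commutes, ← mul_assoc, ← mul_assoc, ← mul_assoc,
        mul_assoc (x j) u, huu', mul_one]
    rw [h2, h1, h3, star_mul, Matrix.conjTranspose_apply, hHx]
  have hA : ∀ j, (U.conj H).A (Fin.last n) j =
      star (star u * μ * u) * (1 : Matrix (Fin (n + 1)) (Fin (n + 1)) ℍ) (Fin.last n) j := by
    intro j
    rw [← hH]
    simp only [Blocks.conj]
    rw [Matrix.mul_apply, Matrix.mul_apply, Finset.mul_sum]
    simp only [hrow, mul_assoc]
  refine ⟨H, star u * μ * u, c * ‖β‖, mul_eq_one_symm hH, by positivity, fun j => ?_, ?_, ?_⟩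
  · rw [hA, Matrix.one_apply_ne (Fin.castSucc_lt_last j).ne', mul_zero]
  · rw [hA, Matrix.one_apply_eq, mul_one]
  · have h1 : (U.conj H).B (Fin.last n) 0 = (c : ℍ) * (star u * β) := by
      simp only [Blocks.conj, Matrix.mul_apply, Matrix.conjTranspose_apply, hHx, star_mul,
        Quaternion.star_coe, hβ, Finset.mul_sum, mul_assoc]
    rw [h1, hβu, ← mul_assoc (star u), huu, one_mul, ← hβu, Quaternion.coe_mul]

/-! ### Splitting off a step -/

/-- The prescribed last state row is that of the elementary factor. Multiplying by the adjoint of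
that factor turns it into a basis row, and unitarity does the same to the matching column, which
splits off `U'`. -/
theorem exists_eq_step {n : ℕ} {U : Blocks (n + 1)} (hU : U.IsUnitary) {a : ℍ} (ha : ‖a‖ ≤ 1)
    (h0 : ∀ j : Fin n, U.A (Fin.last n) j.castSucc = 0)
    (h1 : U.A (Fin.last n) (Fin.last n) = star a)
    (h2 : U.B (Fin.last n) 0 = ((Real.sqrt (1 - ‖a‖ ^ 2) : ℝ) : ℍ)) :
    ∃ U' : Blocks n, U'.IsUnitary ∧ U = U'.step a := by
  rw [isUnitary_iff] at hU
  have hE := mul_eq_one_symm (elementary_mul_star n ha)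
  set W := U.toMatrix.submatrix (stateEquiv n).symm (stateEquiv n).symm * star (elementary n a)
    with hW
  have hs := coe_sqrt_mul_self ha
  have hWW : W * star W = 1 := by
    rw [hW, star_mul, star_star, mul_assoc, ← mul_assoc (star (elementary n a)), hE, one_mul,
      Matrix.star_eq_conjTranspose, Matrix.conjTranspose_submatrix, Matrix.submatrix_mul_equiv,
      ← Matrix.star_eq_conjTranspose, hU, Matrix.submatrix_one_equiv]
  have e1 : ∀ i, (stateEquiv n).symm (Sum.inl (Sum.inl i)) = Sum.inl i.castSucc := fun i => by
    rw [Equiv.symm_apply_eq, stateEquiv_inl_castSucc]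
  have e2 : (stateEquiv n).symm (Sum.inr 0) = Sum.inl (Fin.last n) := by
    rw [Equiv.symm_apply_eq, stateEquiv_inl_last]
  have e3 : (stateEquiv n).symm (Sum.inl (Sum.inr 0)) = Sum.inr 0 := by
    rw [Equiv.symm_apply_eq, stateEquiv_inr]
  have hrow : ∀ j, W (Sum.inr 0) j = if j = Sum.inr 0 then 1 else 0 := by
    have h3 : star a * a = a * star a := by
      rw [Quaternion.star_mul_self, Quaternion.self_mul_star]
    intro j
    rcases j with (j | j) | j
    · simp [hW, Matrix.mul_apply, Fintype.sum_sum_type, e1, e2, Blocks.toMatrix, h0, elementary,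
        Matrix.star_apply]
    · obtain rfl := Subsingleton.elim j 0
      simp [hW, Matrix.mul_apply, Fintype.sum_sum_type, e1, e2, e3, Blocks.toMatrix, h0, h1, h2,
        elementary, Matrix.star_apply, Quaternion.coe_commutes]
    · obtain rfl := Subsingleton.elim j 0
      simp [hW, Matrix.mul_apply, Fintype.sum_sum_type, e1, e2, e3, Blocks.toMatrix, h0, h1, h2,
        elementary, Matrix.star_apply, hs, h3, -Quaternion.coe_mul]
  have hcol : ∀ i, W (Sum.inl i) (Sum.inr 0) = 0 := by
    intro i
    have h3 := congrFun (congrFun hWW (Sum.inl i)) (Sum.inr 0)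
    rw [Matrix.mul_apply] at h3
    simp only [Matrix.star_apply, hrow, apply_ite star, star_one, star_zero, mul_ite, mul_one,
      mul_zero, Finset.sum_ite_eq', Finset.mem_univ, if_true] at h3
    rw [h3, Matrix.one_apply_ne (by simp)]
  let U' : Blocks n :=
    { A := W.toBlocks₁₁.toBlocks₁₁
      B := W.toBlocks₁₁.toBlocks₁₂
      C := W.toBlocks₁₁.toBlocks₂₁
      D := W (Sum.inl (Sum.inr 0)) (Sum.inl (Sum.inr 0)) }
  have hU' : U'.toMatrix = W.toBlocks₁₁ := by
    ext1 i j
    rcases i with i | i <;> rcases j with j | j <;> try rfl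
    obtain rfl := Subsingleton.elim i 0
    obtain rfl := Subsingleton.elim j 0
    rfl
  have hWb : W = Matrix.fromBlocks U'.toMatrix 0 0 1 := by
    ext1 i j
    rcases i with i | i <;> rcases j with j | j
    · rw [hU']
      rfl
    · obtain rfl := Subsingleton.elim j 0
      exact hcol i
    · obtain rfl := Subsingleton.elim i 0
      simp [hrow]
    · obtain rfl := Subsingleton.elim i 0
      obtain rfl := Subsingleton.elim j 0
      simp [hrow]
  have hUs : U.toMatrix = (U'.step a).toMatrix := by
    rw [toMatrix_step, ← hWb, hW, mul_assoc, hE, mul_one]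
    simp
  refine ⟨U', ?_, ?_⟩
  · rw [hWb, fromBlocks_one_mul_star, ← Matrix.fromBlocks_one, Matrix.fromBlocks_inj] at hWW
    exact (isUnitary_iff U').mpr hWW.1
  · obtain ⟨hA, hB, hC, hD⟩ := Matrix.fromBlocks_inj.mp hUs
    have hD' := congrFun (congrFun hD 0) 0
    cases U
    simp only [Blocks.step, Blocks.mk.injEq]
    exact ⟨hA, hB, hC, hD'⟩

/-- A unitary matrix of blocks with stable `A` is, up to unitary similarity, a step. -/
theorem exists_conj_eq_step {n : ℕ} {U : Blocks (n + 1)} (hU : U.IsUnitary) (hA : IsStable U.A) :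
    ∃ (H : Matrix (Fin (n + 1)) (Fin (n + 1)) ℍ) (a : ℍ) (U' : Blocks n), H * Hᴴ = 1 ∧
      ‖a‖ < 1 ∧ U'.IsUnitary ∧ IsStable U'.A ∧ U.conj H = U'.step a := by
  obtain ⟨H, a, s, hH, hs, h0, h1, h2⟩ := exists_conj_last_row U
  have hU' := hU.conj hH
  have hA' := hA.conj hH
  have hUU := (isUnitary_iff _).mp hU'
  have hrow : ∀ i, star a * star ((U.conj H).toMatrix i (Sum.inl (Fin.last n))) +
      (s : ℍ) * star ((U.conj H).toMatrix i (Sum.inr 0)) =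
      (1 : Matrix (Fin (n + 1) ⊕ Fin 1) (Fin (n + 1) ⊕ Fin 1) ℍ) (Sum.inl (Fin.last n)) i := by
    intro i
    rw [← hUU, Matrix.mul_apply]
    simp [Fintype.sum_sum_type, Fin.sum_univ_castSucc, Matrix.star_apply, Blocks.toMatrix, h0, h1,
      h2]
  -- The only possibly nonzero entries of this unit row are `ā` and `s`.
  have hnorm : ‖a‖ ^ 2 + s ^ 2 = 1 := by
    have := hrow (Sum.inl (Fin.last n))
    simp only [Blocks.toMatrix, Matrix.fromBlocks_apply₁₁, Matrix.fromBlocks_apply₁₂, h1, h2,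
      star_star, Matrix.one_apply_eq, star_mul_self_eq_norm_sq, Quaternion.star_coe] at this
    rw [← Quaternion.coe_mul, ← Quaternion.coe_add, ← Quaternion.coe_one,
      Quaternion.coe_inj] at this
    rw [← this]
    ring
  have ha : ‖a‖ < 1 := by
    -- If `‖a‖ ≥ 1` then `s = 0`, and orthogonality to the last state row kills the rest of the last
    -- column of `A`. The last basis vector is then an eigenvector for `ā`, against stability.
    by_contra! hlt
    have hs0 : s = 0 := by nlinarith
    have ha0 : star a ≠ 0 := by
      rw [star_ne_zero, ← norm_ne_zero_iff]
      linarith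
    have heig : IsRightEigenvalue (U.conj H).A (star a) := by
      refine ⟨Pi.single (Fin.last n) 1, by simp, ?_⟩
      rw [Matrix.mulVec_single_one]
      ext1 i
      rw [Matrix.col_apply]
      refine Fin.lastCases ?_ (fun i => ?_) i
      · simp [h1]
      · have := hrow (Sum.inl i.castSucc)
        rw [hs0, Matrix.one_apply_ne (by simpa using (Fin.castSucc_lt_last i).ne')] at this
        simpa [Blocks.toMatrix, ha0, star_ne_zero.mp ha0] using this
    have := hA' heig
    simp at this
    linarith
  have hs' : s = Real.sqrt (1 - ‖a‖ ^ 2) := by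
    rw [← hnorm, add_sub_cancel_left, Real.sqrt_sq hs]
  obtain ⟨U', hU1, hU2⟩ := exists_eq_step hU' ha.le h0 h1 (by rw [h2, hs'])
  exact ⟨H, a, U', hH, ha, hU1, (isStable_step_iff U' ha).mp (hU2 ▸ hA'), hU2⟩

/-! ### Moving unimodular constants through Blaschke factors -/

theorem C_mul_kernelSeries {φ : ℍ} (hφ : ‖φ‖ = 1) (a : ℍ) :
    PowerSeries.C φ * kernelSeries a = kernelSeries (φ * a * star φ) * PowerSeries.C φ := by
  have h : star φ * φ = 1 := by rw [star_mul_self_eq_norm_sq, hφ]; simp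
  ext1 k
  simp only [kernelSeries, PowerSeries.coeff_C_mul, PowerSeries.coeff_mul_C, PowerSeries.coeff_mk]
  induction k with
  | zero => simp
  | succ k ih =>
    rw [pow_succ, ← mul_assoc, ih, pow_succ]
    simp only [star_mul, star_star, mul_assoc, h, mul_one]

/-- Conjugation by a unit quaternion is an automorphism compatible with `star`. It lets the constant
be kept at the right end when a new factor is appended, at the price of rotating the node. -/
theorem C_mul_blaschkeFactor {φ : ℍ} (hφ : ‖φ‖ = 1) (a : ℍ) :
    PowerSeries.C φ * blaschkeFactor a =
      blaschkeFactor (φ * a * star φ) * PowerSeries.C φ := by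
  have h : star φ * φ = 1 := by rw [star_mul_self_eq_norm_sq, hφ]; simp
  have h1 : PowerSeries.C φ * (PowerSeries.X - PowerSeries.C a) =
      (PowerSeries.X - PowerSeries.C (φ * a * star φ)) * PowerSeries.C φ := by
    rw [mul_sub, sub_mul, ← PowerSeries.X_mul, ← map_mul, ← map_mul, mul_assoc _ (star φ), h,
      mul_one]
  rw [blaschkeFactor, blaschkeFactor, ← mul_assoc, h1, mul_assoc, C_mul_kernelSeries hφ,
    ← mul_assoc]

theorem IsBlaschkeProduct.mul_blaschkeFactor {n : ℕ} {f : ℍ⟦X⟧} (hf : IsBlaschkeProduct n f)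
    {a : ℍ} (ha : ‖a‖ < 1) : IsBlaschkeProduct (n + 1) (f * blaschkeFactor a) := by
  obtain ⟨α, φ, hα, hφ, rfl⟩ := hf
  refine ⟨Fin.snoc α (φ * a * star φ), φ, fun i => ?_, hφ, ?_⟩
  · refine Fin.lastCases ?_ (fun i => ?_) i
    · simpa [norm_mul, hφ] using ha
    · simpa using hα i
  · rw [blaschkeProduct_succ, Fin.init_snoc, Fin.snoc_last, mul_assoc, ← C_mul_blaschkeFactor hφ,
      ← mul_assoc]
    simp [blaschkeProduct]

theorem isBlaschkeProduct_transfer {n : ℕ} (U : Blocks n) (hU : U.IsUnitary)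
    (hA : IsStable U.A) : IsBlaschkeProduct n U.transfer := by
  induction n with
  | zero =>
    refine ⟨Fin.elim0, U.D, fun i => i.elim0, ?_, ?_⟩
    · have := congrFun (congrFun ((isUnitary_iff U).mp hU) (Sum.inr 0)) (Sum.inr 0)
      simp only [Matrix.mul_apply, Fintype.sum_sum_type, Matrix.star_apply, Blocks.toMatrix,
        Finset.univ_eq_empty, Finset.sum_empty, zero_add, Finset.univ_unique, Finset.sum_singleton,
        Matrix.fromBlocks_apply₂₂, Matrix.one_apply_eq] at this
      have h : U.D * star U.D = 1 := this
      rw [mul_star_self_eq_norm_sq, ← Quaternion.coe_one, Quaternion.coe_inj] at h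
      nlinarith [norm_nonneg U.D]
    · rw [transfer_eq_of_state U 0 fun i => i.elim0]
      simp [blaschkeProduct]
  | succ n ih =>
    obtain ⟨H, a, U', hH, ha, hU', hA', h⟩ := exists_conj_eq_step hU hA
    rw [← transfer_conj U hH, h, transfer_step U' ha.le]
    exact (ih U' hU' hA').mul_blaschkeFactor ha

/-! ### The degree is determined by the series -/

/-- The power series with conjugated coefficients. -/
noncomputable def conjSeries (f : ℍ⟦X⟧) : ℍ⟦X⟧ :=
  PowerSeries.mk fun k => star (PowerSeries.coeff k f)

@[simp] theorem coeff_conjSeries (f : ℍ⟦X⟧) (k : ℕ) :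
    PowerSeries.coeff k (conjSeries f) = star (PowerSeries.coeff k f) :=
  PowerSeries.coeff_mk _ _

theorem conjSeries_mul (f g : ℍ⟦X⟧) : conjSeries (f * g) = conjSeries g * conjSeries f := by
  ext1 k
  rw [coeff_conjSeries, PowerSeries.coeff_mul, PowerSeries.coeff_mul, star_sum,
    ← Finset.Nat.sum_antidiagonal_swap]
  simp

@[simp] theorem conjSeries_C (a : ℍ) : conjSeries (PowerSeries.C a) = PowerSeries.C (star a) := by
  ext1 k
  simp [PowerSeries.coeff_C, apply_ite star]

@[simp] theorem conjSeries_X : conjSeries PowerSeries.X = PowerSeries.X := by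
  ext1 k
  simp [PowerSeries.coeff_X, apply_ite star]

@[simp] theorem conjSeries_one : conjSeries 1 = 1 := by
  rw [← map_one PowerSeries.C, conjSeries_C, star_one]

theorem conjSeries_sub (f g : ℍ⟦X⟧) : conjSeries (f - g) = conjSeries f - conjSeries g := by
  ext1 k
  simp

/-! ### Real polynomials attached to a Blaschke product -/

/-- Real polynomials as quaternionic power series. -/
noncomputable def ofRealPoly : Polynomial ℝ →+* ℍ⟦X⟧ :=
  (PowerSeries.map (algebraMap ℝ ℍ)).comp (Polynomial.coeToPowerSeries.ringHom)

theorem coeff_ofRealPoly (p : Polynomial ℝ) (k : ℕ) :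
    PowerSeries.coeff k (ofRealPoly p) = ((p.coeff k : ℝ) : ℍ) := by
  simp [ofRealPoly]

theorem ofRealPoly_injective : Function.Injective ofRealPoly := by
  intro p q h
  ext1 k
  have := congrArg (PowerSeries.coeff k) h
  rwa [coeff_ofRealPoly, coeff_ofRealPoly, Quaternion.coe_inj] at this

theorem ofRealPoly_mul_comm (p : Polynomial ℝ) (f : ℍ⟦X⟧) :
    ofRealPoly p * f = f * ofRealPoly p := by
  ext1 k
  rw [PowerSeries.coeff_mul, PowerSeries.coeff_mul, ← Finset.Nat.sum_antidiagonal_swap]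
  simp [coeff_ofRealPoly, Quaternion.coe_commutes]

/-- The real polynomial `(z - α)(z - ᾱ)`. -/
noncomputable def nodePoly (α : ℍ) : Polynomial ℝ :=
  Polynomial.X ^ 2 + Polynomial.C (-(2 * α.re)) * Polynomial.X + Polynomial.C (‖α‖ ^ 2)

/-- The real polynomial `(1 - z α)(1 - z ᾱ)`. -/
noncomputable def polePoly (α : ℍ) : Polynomial ℝ :=
  Polynomial.C (‖α‖ ^ 2) * Polynomial.X ^ 2 + Polynomial.C (-(2 * α.re)) * Polynomial.X + 1

/-- Monic, so the degree is 2 even for `α = 0`, where `polePoly` degenerates to 1. Degrees are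
therefore counted with `nodePoly`. -/
theorem natDegree_nodePoly (α : ℍ) : (nodePoly α).natDegree = 2 := by
  unfold nodePoly
  compute_degree!

theorem nodePoly_ne_zero (α : ℍ) : nodePoly α ≠ 0 := by
  intro h
  simpa [h] using natDegree_nodePoly α

@[simp] theorem ofRealPoly_X : ofRealPoly Polynomial.X = PowerSeries.X := by
  simp [ofRealPoly]

@[simp] theorem ofRealPoly_C (r : ℝ) : ofRealPoly (Polynomial.C r) = PowerSeries.C (r : ℍ) := by
  simp [ofRealPoly]

theorem coe_neg_two_mul_re (α : ℍ) : ((-(2 * α.re) : ℝ) : ℍ) = -(α + star α) := by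
  rw [Quaternion.self_add_star]
  push_cast
  rfl

theorem X_commute_C (a : ℍ) :
    (PowerSeries.C a : ℍ⟦X⟧) * PowerSeries.X = PowerSeries.X * PowerSeries.C a :=
  PowerSeries.X_mul.symm

theorem ofRealPoly_nodePoly (α : ℍ) : ofRealPoly (nodePoly α) =
    (PowerSeries.X - PowerSeries.C α) * (PowerSeries.X - PowerSeries.C (star α)) := by
  simp only [nodePoly, map_add, map_mul, map_pow (f := ofRealPoly), ofRealPoly_X, ofRealPoly_C]
  rw [coe_neg_two_mul_re, ← mul_star_self_eq_norm_sq]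
  simp only [map_neg, map_add, map_mul, mul_sub, sub_mul, add_mul, neg_mul, X_commute_C, sq]
  abel

theorem ofRealPoly_polePoly (α : ℍ) : ofRealPoly (polePoly α) =
    (1 - PowerSeries.X * PowerSeries.C α) * (1 - PowerSeries.X * PowerSeries.C (star α)) := by
  simp only [polePoly, map_add, map_mul, map_pow (f := ofRealPoly), map_one, ofRealPoly_X,
    ofRealPoly_C]
  rw [coe_neg_two_mul_re, ← mul_star_self_eq_norm_sq]
  have h : PowerSeries.X * PowerSeries.C α * (PowerSeries.X * PowerSeries.C (star α)) =
      PowerSeries.C α * PowerSeries.C (star α) * PowerSeries.X ^ 2 := by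
    rw [← X_commute_C, ← X_commute_C, mul_assoc, ← mul_assoc PowerSeries.X, ← X_commute_C, sq]
    simp only [mul_assoc]
  rw [sub_mul, one_mul, mul_sub, mul_one, h]
  simp only [map_neg, map_add, map_mul, add_mul, neg_mul, X_commute_C]
  abel

theorem polePoly_mul_blaschkeFactor (α : ℍ) :
    ofRealPoly (polePoly α) * (blaschkeFactor α * conjSeries (blaschkeFactor α)) =
      ofRealPoly (nodePoly α) := by
  have h1 := one_sub_mul_kernelSeries α
  have h2 : conjSeries (kernelSeries α) * (1 - PowerSeries.X * PowerSeries.C α) = 1 := by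
    have := congrArg conjSeries h1
    rwa [conjSeries_mul, conjSeries_sub, conjSeries_mul, conjSeries_one, conjSeries_X,
      conjSeries_C, star_star, ← PowerSeries.X_mul] at this
  have h3 : (1 - PowerSeries.X * PowerSeries.C α) * conjSeries (kernelSeries α) = 1 := by
    have := congrArg conjSeries (kernelSeries_mul_one_sub α)
    rwa [conjSeries_mul, conjSeries_sub, conjSeries_mul, conjSeries_one, conjSeries_X,
      conjSeries_C, star_star, ← PowerSeries.X_mul] at this
  have h4 : ofRealPoly (polePoly α) * (kernelSeries α * conjSeries (kernelSeries α)) = 1 := by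
    rw [ofRealPoly_polePoly, mul_assoc, ← mul_assoc _ (kernelSeries α), h1, one_mul, h3]
  rw [blaschkeFactor, conjSeries_mul, conjSeries_sub, conjSeries_X, conjSeries_C,
    ofRealPoly_nodePoly]
  -- The central pole polynomial is moved next to the two kernels, which it cancels.
  calc _ = ofRealPoly (polePoly α) * (PowerSeries.X - PowerSeries.C α) *
        (kernelSeries α * conjSeries (kernelSeries α)) *
          (PowerSeries.X - PowerSeries.C (star α)) := by simp only [mul_assoc]
    _ = _ := by rw [ofRealPoly_mul_comm, mul_assoc _ (ofRealPoly _), h4, mul_one]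

/-- The innermost product of a factor with its conjugate is, after clearing its pole polynomial, a
real polynomial, hence central. It can be pulled out of the product. -/
theorem normSeries_blaschkeProduct_one {n : ℕ} (α : Fin n → ℍ) :
    ofRealPoly (∏ i, polePoly (α i)) *
      (blaschkeProduct α 1 * conjSeries (blaschkeProduct α 1)) =
      ofRealPoly (∏ i, nodePoly (α i)) := by
  induction n with
  | zero => simp [blaschkeProduct]
  | succ n ih =>
    have hi := ih (Fin.init α)
    rw [blaschkeProduct_succ, map_one, mul_one, Fin.prod_univ_castSucc, Fin.prod_univ_castSucc,
      map_mul, map_mul, conjSeries_mul]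
    change ofRealPoly (∏ i : Fin n, polePoly (α i.castSucc)) * _ =
      ofRealPoly (∏ i : Fin n, nodePoly (α i.castSucc)) at hi
    set g := blaschkeProduct (Fin.init α) 1
    set b := blaschkeFactor (α (Fin.last n))
    set Q := ofRealPoly (∏ i : Fin n, polePoly (α i.castSucc))
    set q := ofRealPoly (polePoly (α (Fin.last n)))
    have hc : q * g = g * q := ofRealPoly_mul_comm _ _
    have hb : q * (b * conjSeries b) = ofRealPoly (nodePoly (α (Fin.last n))) :=
      polePoly_mul_blaschkeFactor _
    rw [← hi]
    calc _ = Q * (q * g) * (b * conjSeries b) * conjSeries g := by simp only [mul_assoc]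
      _ = Q * g * (q * (b * conjSeries b)) * conjSeries g := by rw [hc]; simp only [mul_assoc]
      _ = _ := by
        rw [hb, mul_assoc, ofRealPoly_mul_comm (nodePoly _)]
        simp only [mul_assoc]

theorem normSeries_blaschkeProduct {n : ℕ} (α : Fin n → ℍ) {φ : ℍ} (hφ : ‖φ‖ = 1) :
    ofRealPoly (∏ i, polePoly (α i)) *
      (blaschkeProduct α φ * conjSeries (blaschkeProduct α φ)) =
      ofRealPoly (∏ i, nodePoly (α i)) := by
  have h : blaschkeProduct α φ = blaschkeProduct α 1 * PowerSeries.C φ := by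
    simp [blaschkeProduct]
  rw [← normSeries_blaschkeProduct_one, h, conjSeries_mul, conjSeries_C, mul_assoc _ (PowerSeries.C φ),
    ← mul_assoc (PowerSeries.C φ), ← map_mul, mul_star_self_eq_norm_sq, hφ]
  simp

/-! ### Coprimality and the comparison of degrees -/

theorem re_sq_le_norm_sq (α : ℍ) : α.re ^ 2 ≤ ‖α‖ ^ 2 := by
  have h := Quaternion.normSq_eq_norm_mul_self α
  rw [Quaternion.normSq_def'] at h
  nlinarith [sq_nonneg α.imI, sq_nonneg α.imJ, sq_nonneg α.imK]

/-- The discriminant is not positive, so the two roots are complex conjugates with product `N`. -/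
theorem normSq_of_quadratic {t N : ℝ} (h : t ^ 2 ≤ N) {w : ℂ}
    (hw : w ^ 2 - 2 * t * w + N = 0) : Complex.normSq w = N := by
  have hre := congrArg Complex.re hw
  have him := congrArg Complex.im hw
  simp [sq] at hre him
  rw [Complex.normSq_apply]
  have h1 : w.im * (w.re - t) = 0 := by linarith
  rcases mul_eq_zero.mp h1 with h2 | h2
  · rw [h2] at hre ⊢
    have h3 : (w.re - t) ^ 2 = 0 := le_antisymm (by nlinarith) (sq_nonneg _)
    have h4 : w.re = t := by
      have := pow_eq_zero_iff two_ne_zero |>.mp h3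
      linarith
    rw [h4] at hre ⊢
    linarith
  · have h4 : w.re = t := by linarith
    rw [h4] at hre ⊢
    linarith

/-- A common complex root would have modulus `‖α‖ < 1`, and its inverse modulus `‖β‖ < 1`. -/
theorem isCoprime_nodePoly_polePoly {α β : ℍ} (hα : ‖α‖ < 1) (hβ : ‖β‖ < 1) :
    IsCoprime (nodePoly α) (polePoly β) := by
  rw [Polynomial.isCoprime_iff_aeval_ne_zero_of_isAlgClosed ℝ ℂ]
  intro w
  by_contra! h
  obtain ⟨h1, h2⟩ := h
  have hw1 : Complex.normSq w = ‖α‖ ^ 2 := by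
    refine normSq_of_quadratic (re_sq_le_norm_sq α) ?_
    rw [← h1]
    simp [nodePoly]
    ring
  have hw0 : w ≠ 0 := by
    rintro rfl
    simp [polePoly] at h2
  have hw2 : Complex.normSq w⁻¹ = ‖β‖ ^ 2 := by
    refine normSq_of_quadratic (re_sq_le_norm_sq β) ?_
    have h3 : (w⁻¹) ^ 2 * Polynomial.aeval w (polePoly β) = 0 := by rw [h2, mul_zero]
    rw [← h3]
    simp [polePoly]
    field_simp
    ring
  rw [Complex.normSq_inv, hw1] at hw2
  have ha : ‖α‖ ^ 2 ≠ 0 := by rw [← hw1]; simpa using hw0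
  have hab : ‖β‖ ^ 2 * ‖α‖ ^ 2 = 1 := by rw [← hw2, inv_mul_cancel₀ ha]
  have h3 : ‖α‖ ^ 2 < 1 := pow_lt_one₀ (norm_nonneg _) hα two_ne_zero
  have h4 : ‖β‖ ^ 2 < 1 := pow_lt_one₀ (norm_nonneg _) hβ two_ne_zero
  exact (mul_lt_one_of_nonneg_of_lt_one_left (sq_nonneg _) h4 h3.le).ne hab

theorem natDegree_prod_nodePoly {n : ℕ} (α : Fin n → ℍ) :
    (∏ i, nodePoly (α i)).natDegree = 2 * n := by
  rw [Polynomial.natDegree_prod _ _ fun i _ => nodePoly_ne_zero _]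
  simp [natDegree_nodePoly, mul_comm]

theorem prod_nodePoly_dvd {n m : ℕ} {α : Fin n → ℍ} {β : Fin m → ℍ} (hα : ∀ i, ‖α i‖ < 1)
    (h : (∏ i, polePoly (β i)) * ∏ i, nodePoly (α i) =
      (∏ i, polePoly (α i)) * ∏ i, nodePoly (β i)) :
    (∏ i, nodePoly (α i)) ∣ ∏ i, nodePoly (β i) := by
  have hc : IsCoprime (∏ i, nodePoly (α i)) (∏ i, polePoly (α i)) :=
    IsCoprime.prod_left fun i _ => IsCoprime.prod_right fun j _ =>
      isCoprime_nodePoly_polePoly (hα i) (hα j)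
  exact hc.dvd_of_dvd_mul_left (h ▸ Dvd.intro_left _ rfl)

/-- Two factorizations give the same norm series. Cross-multiplying and cancelling the coprime pole
polynomials makes the two node polynomials divide each other, so `2 * n = 2 * m`. -/
theorem IsBlaschkeProduct.degree_unique {n m : ℕ} {f : ℍ⟦X⟧} (hn : IsBlaschkeProduct n f)
    (hm : IsBlaschkeProduct m f) : m = n := by
  obtain ⟨α, φ, hα, hφ, h1⟩ := hn
  obtain ⟨β, ψ, hβ, hψ, h2⟩ := hm
  have e1 := normSeries_blaschkeProduct α hφ
  have e2 := normSeries_blaschkeProduct β hψ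
  rw [← h1] at e1
  rw [← h2] at e2
  have h : (∏ i, polePoly (β i)) * ∏ i, nodePoly (α i) =
      (∏ i, polePoly (α i)) * ∏ i, nodePoly (β i) := by
    apply ofRealPoly_injective
    rw [map_mul, map_mul, ← e1, ← e2, ← mul_assoc, ← mul_assoc (ofRealPoly _) (ofRealPoly _),
      ofRealPoly_mul_comm _ (ofRealPoly _)]
  have hd1 := Polynomial.natDegree_le_of_dvd (prod_nodePoly_dvd hα h)
    (Finset.prod_ne_zero_iff.mpr fun i _ => nodePoly_ne_zero _)
  have hd2 := Polynomial.natDegree_le_of_dvd (prod_nodePoly_dvd hβ h.symm)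
    (Finset.prod_ne_zero_iff.mpr fun i _ => nodePoly_ne_zero _)
  rw [natDegree_prod_nodePoly, natDegree_prod_nodePoly] at hd1 hd2
  omega

end QBlaschke

theorem theorem3 :
    -- a stable unitary matrix of size `n + 1` gives a Blaschke product of degree exactly `n`
    (∀ (n : ℕ) (U : QBlaschke.Blocks n), U.IsUnitary → QBlaschke.IsStable U.A →
      QBlaschke.IsBlaschkeProduct n U.transfer ∧
        ∀ m : ℕ, QBlaschke.IsBlaschkeProduct m U.transfer → m = n) ∧
    -- every finite Blaschke product of degree `n` has a stable unitary realization of size `n + 1`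
    (∀ (n : ℕ) (f : ℍ⟦X⟧), QBlaschke.IsBlaschkeProduct n f →
      ∃ U : QBlaschke.Blocks n, U.IsUnitary ∧ QBlaschke.IsStable U.A ∧ f = U.transfer) ∧
    -- for every factorization such a realization is given by the recursive construction
    (∀ (n : ℕ) (α : Fin n → ℍ) (φ : ℍ), (∀ i, ‖α i‖ < 1) → ‖φ‖ = 1 →
      ((QBlaschke.recursiveBlocks n α).mulConst φ).IsUnitary ∧
        QBlaschke.IsStable ((QBlaschke.recursiveBlocks n α).mulConst φ).A ∧
        QBlaschke.blaschkeProduct α φ =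
          ((QBlaschke.recursiveBlocks n α).mulConst φ).transfer) := by
  refine ⟨fun n U hU hA => ?_, ?_, fun n α φ hα hφ =>
    QBlaschke.recursiveBlocks_mulConst_spec α φ hα hφ⟩
  · have h := QBlaschke.isBlaschkeProduct_transfer U hU hA
    exact ⟨h, fun m hm => h.degree_unique hm⟩
  · rintro n f ⟨α, φ, hα, hφ, rfl⟩
    exact ⟨_, QBlaschke.recursiveBlocks_mulConst_spec α φ hα hφ⟩
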